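/- Conventions. For a cardinal $\theta$, $H(\theta)$ is the set of all sets whose transitive closure has cardinality less than $\theta$; for a set $X$, $\mathscr{P}_\kappa X=\{y\subseteq X : |y|<\kappa\}$. A set $C\subseteq\mathscr{P}_\kappa X$ is \emph{cofinal} if every $x\in\mathscr{P}_\kappa X$ is contained in some $y\in C$; it is a \emph{club} (resp. a \emph{strong club}) if it is cofinal and $\bigcup D\in C$ for every nonempty $D\subseteq C$ with $|D|<\kappa$ that is linearly ordered by $\subseteq$ (resp. for every nonempty $D\subseteq C$ with $|D|<\kappa$). A set $B\subseteq\mathscr{P}_\kappa X$ is \emph{weakly stationary} if it meets every strong club in $\mathscr{P}_\kappa X$. Let $\mu\le\kappa\le\theta$ be uncountable cardinals with $\kappa,\theta$ regular. For $M\subseteq H(\theta)$, $x\in M$ and $d\subseteq x$: $d$ is \emph{$(\mu,M)$-approximated} if for every $z\in M\cap\mathscr{P}_\mu(x)$ there is $e\in M$ with $d\cap z=e\cap z$; and $d$ is \emph{$N$-guessed} if there is $e\in N$ with $d\cap N=e\cap N$. For $S\subseteq\mathscr{P}_\kappa H(\theta)$, the pair $(M,x)$ is \emph{almost $\mu$-guessed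 by $S$} if $x\in M$ and for every $(\mu,M)$-approximated $d\subseteq x$ there is $N\in S$ with $x\in N\subseteq M$ such that $d$ is $N$-guessed. $\mathsf{wAGP}(\mu,\kappa,\theta)$ is the assertion that for every cofinal $S\subseteq\mathscr{P}_\kappa H(\theta)$ and every $x\in H(\theta)$, the set of $M\in\mathscr{P}_\kappa H(\theta)$ such that $(M,x)$ is almost $\mu$-guessed by $S$ is weakly stationary in $\mathscr{P}_\kappa H(\theta)$. A \emph{$(\kappa,\lambda)$-list} is a sequence $D=\langle d_x : x\in\mathscr{P}_\kappa\lambda\rangle$ with $d_x\subseteq x$ for all $x$. It is \emph{$\mu$-slender} if for all sufficiently large cardinals $\theta$ there is a club $C\subseteq\mathscr{P}_\kappa H(\theta)$ such that $d_{M\cap\lambda}\cap y\in M$ for all $M\in C$ and all $y\in M\cap\mathscr{P}_\mu\lambda$. A \emph{cofinal branch} of $D$ is a set $d\subseteq\lambda$ such that for every $x\in\mathscr{P}_\kappa\lambda$ there is $z\in\mathscr{P}_\kappa\lambda$ with $z\supseteq x$ and $d\cap x=d_z\cap x$. $\mathsf{SP}(\mu,\kappa,\lambda)$ is the assertion that every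 $\mu$-slender $(\kappa,\lambda)$-list has a cofinal branch. A \emph{tree} is a partial order in which the set of predecessors of each node is well-ordered; a \emph{cofinal branch} of a tree is a downward closed chain meeting every level below the height of the tree. A \emph{weak $\mu$-Kurepa tree} is a tree of height and cardinality $\mu$ with at least $\mu^+$ cofinal branches. \textbf{Theorem.} (1) Let $\mu$ be a regular uncountable cardinal. If $\mathsf{wAGP}(\mu,\mu^+,\mu^+)$ holds, then there are no weak $\mu$-Kurepa trees, i.e. every tree of height and cardinality $\mu$ has at most $\mu$ cofinal branches. (2) If $\mathsf{SP}(\omega_1,\omega_2,|H(\omega_2)|)$ holds, then there is no weak $\omega_1$-Kurepa tree. -/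

import Mathlib

universe u

noncomputable section

namespace TwoCardinal

open Cardinal

/-! ### The structures `H(θ)` and `𝒫_κ X` -/

/-- A transitive set has elements of every rank below its own. -/
theorem exists_mem_rank_eq {t : ZFSet.{u}} (ht : t.IsTransitive) {α : Ordinal.{u}}
    (hα : α < t.rank) : ∃ y ∈ t, y.rank = α := by
  by_contra! hne
  have key : ∀ y : ZFSet.{u}, y ∈ t → ¬ α ≤ y.rank := by
    intro y
    induction y using ZFSet.inductionOn with
    | h y ih =>
      intro hy hle
      have hlt : α < y.rank := lt_of_le_of_ne hle (fun h => hne y hy h.symm)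
      obtain ⟨z, hz, hαz⟩ := ZFSet.lt_rank_iff.1 hlt
      exact ih z hz (ht.subset_of_mem hy hz) hαz
  obtain ⟨y, hy, hle⟩ := ZFSet.lt_rank_iff.1 hα
  exact key y hy hle

/-- The rank of a transitive set has at most as many elements as the set. -/
theorem card_rank_le {t : ZFSet.{u}} (ht : t.IsTransitive) : t.rank.card ≤ t.card := by
  rw [← Cardinal.lift_le.{u + 1}, ← ZFSet.cardinalMk_coe_sort, ← Cardinal.mk_Iio_ordinal]
  refine Cardinal.mk_le_of_surjective
    (f := fun y : t => (⟨y.1.rank, ZFSet.rank_lt_of_mem y.2⟩ : Set.Iio t.rank)) ?_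
  rintro ⟨α, hα⟩
  obtain ⟨y, hy, rfl⟩ := exists_mem_rank_eq ht hα
  exact ⟨⟨y, hy⟩, rfl⟩

/-- `H(θ)`: the set of all `x` whose transitive closure has cardinality less than `θ`, i.e. of all
`x` contained in some transitive set of cardinality less than `θ`. All such `x` have rank less than
`θ`, so that they form a set; see `mem_H`. -/
def H (θ : Cardinal.{u}) : ZFSet.{u} :=
  (ZFSet.vonNeumann θ.ord).sep fun x => ∃ t : ZFSet.{u}, t.IsTransitive ∧ x ⊆ t ∧ t.card < θ

theorem mem_H {θ : Cardinal.{u}} {x : ZFSet.{u}} :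
    x ∈ H θ ↔ ∃ t : ZFSet.{u}, t.IsTransitive ∧ x ⊆ t ∧ t.card < θ := by
  rw [H, ZFSet.mem_sep, ZFSet.mem_vonNeumann]
  refine ⟨fun h => h.2, fun h => ⟨?_, h⟩⟩
  obtain ⟨t, ht, hxt, hcard⟩ := h
  exact (ZFSet.rank_mono hxt).trans_lt (Cardinal.lt_ord.2 ((card_rank_le ht).trans_lt hcard))

/-- `𝒫_κ X`: the collection of all subsets of `X` of cardinality less than `κ`. -/
def Pk (κ : Cardinal.{u}) (X : ZFSet.{u}) : Set ZFSet.{u} :=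
  {y | y ⊆ X ∧ y.card < κ}

/-! ### Clubs, strong clubs, weak stationarity -/

/-- `C` is cofinal in `𝒫_κ X`. -/
def IsCofinalIn (κ : Cardinal.{u}) (X : ZFSet.{u}) (C : Set ZFSet.{u}) : Prop :=
  C ⊆ Pk κ X ∧ ∀ x ∈ Pk κ X, ∃ y ∈ C, x ⊆ y

/-- `C` is a club in `𝒫_κ X`: it is cofinal, and closed under unions of nonempty chains of
cardinality less than `κ`. -/
def IsClubIn (κ : Cardinal.{u}) (X : ZFSet.{u}) (C : Set ZFSet.{u}) : Prop :=
  IsCofinalIn κ X C ∧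
    ∀ D : ZFSet.{u}, D.Nonempty → (∀ y ∈ D, y ∈ C) → D.card < κ →
      (∀ y ∈ D, ∀ z ∈ D, y ⊆ z ∨ z ⊆ y) → D.sUnion ∈ C

/-- `C` is a strong club in `𝒫_κ X`: it is cofinal, and closed under unions of arbitrary nonempty
subfamilies of cardinality less than `κ`. -/
def IsStrongClubIn (κ : Cardinal.{u}) (X : ZFSet.{u}) (C : Set ZFSet.{u}) : Prop :=
  IsCofinalIn κ X C ∧
    ∀ D : ZFSet.{u}, D.Nonempty → (∀ y ∈ D, y ∈ C) → D.card < κ → D.sUnion ∈ C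

/-- `B` is a weakly stationary subset of `𝒫_κ X`: it meets every strong club. -/
def IsWeaklyStationaryIn (κ : Cardinal.{u}) (X : ZFSet.{u}) (B : Set ZFSet.{u}) : Prop :=
  B ⊆ Pk κ X ∧ ∀ C : Set ZFSet.{u}, IsStrongClubIn κ X C → (B ∩ C).Nonempty

/-! ### The weak almost guessing property -/

/-- The subset `d` of `x ∈ M` is `(μ, M)`-approximated. -/
def IsApproximated (μ : Cardinal.{u}) (M x d : ZFSet.{u}) : Prop :=
  ∀ z ∈ M, z ∈ Pk μ x → ∃ e ∈ M, d ∩ z = e ∩ z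

/-- The set `d` is `N`-guessed. -/
def IsGuessed (N d : ZFSet.{u}) : Prop :=
  ∃ e ∈ N, d ∩ N = e ∩ N

/-- `(M, x)` is almost `μ`-guessed by `S`. -/
def AlmostGuessed (μ : Cardinal.{u}) (S : Set ZFSet.{u}) (M x : ZFSet.{u}) : Prop :=
  x ∈ M ∧ ∀ d : ZFSet.{u}, d ⊆ x → IsApproximated μ M x d →
    ∃ N ∈ S, x ∈ N ∧ N ⊆ M ∧ IsGuessed N d

/-- The principle `wAGP(μ, κ, θ)`. -/
def WAGP (μ κ θ : Cardinal.{u}) : Prop :=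
  ∀ S : Set ZFSet.{u}, IsCofinalIn κ (H θ) S → ∀ x ∈ H θ,
    IsWeaklyStationaryIn κ (H θ) {M | M ∈ Pk κ (H θ) ∧ AlmostGuessed μ S M x}

/-! ### The slender tree property -/

/-- `d` is a `(κ, X)`-list. Only the values of `d` on `𝒫_κ X` are relevant. -/
def IsPkList (κ : Cardinal.{u}) (X : ZFSet.{u}) (d : ZFSet.{u} → ZFSet.{u}) : Prop :=
  ∀ x ∈ Pk κ X, d x ⊆ x

/-- The `(κ, X)`-list `d` is `μ`-slender. -/
def IsSlender (μ κ : Cardinal.{u}) (X : ZFSet.{u}) (d : ZFSet.{u} → ZFSet.{u}) : Prop :=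
  ∃ θ₀ : Cardinal.{u}, ∀ θ : Cardinal.{u}, θ₀ ≤ θ →
    ∃ C : Set ZFSet.{u}, IsClubIn κ (H θ) C ∧
      ∀ M ∈ C, ∀ y ∈ M, y ∈ Pk μ X → d (M ∩ X) ∩ y ∈ M

/-- `b` is a cofinal branch of the `(κ, X)`-list `d`. -/
def IsListBranch (κ : Cardinal.{u}) (X : ZFSet.{u}) (d : ZFSet.{u} → ZFSet.{u})
    (b : ZFSet.{u}) : Prop :=
  b ⊆ X ∧ ∀ x ∈ Pk κ X, ∃ z ∈ Pk κ X, x ⊆ z ∧ b ∩ x = d z ∩ x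

/-- The slender tree property `SP(μ, κ, X)`. -/
def SPOn (μ κ : Cardinal.{u}) (X : ZFSet.{u}) : Prop :=
  ∀ d : ZFSet.{u} → ZFSet.{u}, IsPkList κ X d → IsSlender μ κ X d →
    ∃ b : ZFSet.{u}, IsListBranch κ X d b

/-- `SP(μ, κ, lam)` for a cardinal `lam`, regarded as the set of all ordinals below it. -/
def SP (μ κ lam : Cardinal.{u}) : Prop :=
  SPOn μ κ lam.ord.toZFSet

/-! ### Trees -/

/-- A tree: a partial order in which the predecessors of every node are well-ordered. -/
def IsTreeOrder (T : Type u) [PartialOrder T] : Prop :=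
  ∀ t : T, IsWellOrder (Set.Iio t) (· < ·)

variable {T : Type u} [PartialOrder T]

/-- The level of a node: the order type of the set of its predecessors. -/
def IsTreeOrder.level (hT : IsTreeOrder T) (t : T) : Ordinal.{u} :=
  haveI := hT t
  Ordinal.type (fun a b : Set.Iio t => a < b)

/-- The height of a tree: the least ordinal above the levels of all nodes. -/
def IsTreeOrder.height (hT : IsTreeOrder T) : Ordinal.{u} :=
  ⨆ t : T, Order.succ (hT.level t)

/-- A cofinal branch: a downward closed chain that meets every level below the height. -/
def IsTreeOrder.IsCofinalBranch (hT : IsTreeOrder T) (b : Set T) : Prop :=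
  IsChain (· ≤ ·) b ∧ IsLowerSet b ∧ ∀ α < hT.height, ∃ t ∈ b, hT.level t = α

/-- A weak `μ`-Kurepa tree: a tree of height and cardinality `μ` with at least `μ⁺` cofinal
branches. -/
def IsWeakKurepaTree (μ : Cardinal.{u}) (T : Type u) [PartialOrder T] : Prop :=
  ∃ hT : IsTreeOrder T, hT.height = μ.ord ∧ #T = μ ∧
    Order.succ μ ≤ #{b : Set T // hT.IsCofinalBranch b}

end TwoCardinal

end

open Cardinal TwoCardinal

namespace TwoCardinal

/-! Code the nodes of a weak Kurepa tree by the ordinals below `μ`. Its branches become more than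
`μ` subsets of `μ`, and by regularity each piece of a branch of size below `μ` is the trace of the
cone below a single node; there are only `μ` such cones. Both principles refute such a family `B`
with approximations `P`.

For `WAGP`, take `M` of size at most `μ` with `P ⊆ M`, and let `S` consist of sets including `μ`.
Every branch is approximated, hence guessed by some `N ⊆ M` with `μ ⊆ N`, so it is `e ∩ μ` for some
`e ∈ M`. This injects `B` into `M`.

For `SP`, diagonalize: inject the subsets of `μ` into `lam` by `p`, and let `d z` be some `b ∈ B`
with `p b ∉ z`. This list is slender because small pieces of `b` come from `P`, but a cofinal branch
through it would put the code of some `d z` into `z`. -/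

/-- A family of more than `μ` subsets of `Ω` all of whose restrictions to sets of cardinality less
than `μ` agree with those of members of the family `P` of at most `μ` subsets of `Ω`. -/
structure IsWeakKurepaFamily (μ : Cardinal.{u}) (Ω B P : ZFSet.{u}) : Prop where
  subset_of_mem : ∀ b ∈ B, b ⊆ Ω
  subset_of_mem_approx : ∀ e ∈ P, e ⊆ Ω
  card_approx_le : P.card ≤ μ
  lt_card : μ < B.card
  exists_approx : ∀ b ∈ B, ∀ z : ZFSet.{u}, z.card < μ → ∃ e ∈ P, b ∩ z = e ∩ z

/-! ### Cardinalities of sets -/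

theorem card_le_of_injective {α : Type u} {x : ZFSet.{u}} (f : α → ZFSet.{u})
    (hf : Function.Injective f) (hx : ∀ a, f a ∈ x) : #α ≤ x.card :=
  mk_le_of_injective (f := fun a => equivShrink x ⟨f a, hx a⟩) fun a b h => hf <| by
    simpa using h

theorem card_le_of_injOn {x y : ZFSet.{u}} (f : ZFSet.{u} → ZFSet.{u})
    (hf : ∀ a ∈ x, ∀ b ∈ x, f a = f b → a = b) (hx : ∀ a ∈ x, f a ∈ y) : x.card ≤ y.card := by
  refine card_le_of_injective (α := Shrink x) (fun a => f ((equivShrink x).symm a)) ?_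
    fun a => hx _ ((equivShrink x).symm a).2
  intro a b h
  exact (equivShrink x).symm.injective (Subtype.ext
    (hf _ ((equivShrink x).symm a).2 _ ((equivShrink x).symm b).2 h))

theorem exists_injOn_of_card_le {x y : ZFSet.{u}} (h : x.card ≤ y.card) :
    ∃ f : ZFSet.{u} → ZFSet.{u}, (∀ a ∈ x, f a ∈ y) ∧ ∀ a ∈ x, ∀ b ∈ x, f a = f b → a = b := by
  classical
  rw [← Cardinal.lift_le.{u + 1}, ← ZFSet.cardinalMk_coe_sort, ← ZFSet.cardinalMk_coe_sort] at h
  obtain ⟨g⟩ := h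
  refine ⟨fun a => if ha : a ∈ x then (g ⟨a, ha⟩ : ZFSet.{u}) else ∅, fun a ha => ?_,
    fun a ha b hb hab => ?_⟩
  · simp only [ha, dite_true]
    exact (g ⟨a, ha⟩).2
  · simp only [ha, hb, dite_true] at hab
    exact congrArg Subtype.val (g.injective (Subtype.ext hab))

theorem card_range_le {α : Type u} (f : α → ZFSet.{u}) : (ZFSet.range f).card ≤ #α := by
  simpa using ZFSet.lift_card_range_le (f := f)

/-! ### From trees to families of sets -/

theorem IsTreeOrder.level_mono {T : Type u} [PartialOrder T] (hT : IsTreeOrder T) {s t : T}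
    (h : s ≤ t) : hT.level s ≤ hT.level t := by
  have := hT s
  have := hT t
  exact Ordinal.type_le_iff'.2 ⟨⟨⟨fun a => ⟨a.1, lt_of_lt_of_le a.2 h⟩,
    fun a b hab => Subtype.ext (congrArg (fun c => c.1) hab)⟩, Iff.rfl⟩⟩

theorem IsTreeOrder.level_lt_height {T : Type u} [PartialOrder T] (hT : IsTreeOrder T) (t : T) :
    hT.level t < hT.height :=
  (Order.lt_succ _).trans_le (Ordinal.le_iSup (fun t => Order.succ (hT.level t)) t)

/-- A level above those of all nodes of `z` decides the trace of a branch on `z`. -/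
theorem IsTreeOrder.IsCofinalBranch.exists_inter_eq {T : Type u} [PartialOrder T]
    {hT : IsTreeOrder T} {μ : Cardinal.{u}} (hμ : μ.IsRegular) (hh : hT.height = μ.ord)
    {b : Set T} (hb : hT.IsCofinalBranch b) {z : Set T} (hz : #z < μ) :
    ∃ t : T, ∀ s ∈ z, s ∈ b ↔ s ≤ t := by
  -- Regularity of `μ` bounds fewer than `μ` levels below the height.
  have hlt : (⨆ s : z, Order.succ (hT.level s.1)) < μ.ord := by
    refine Ordinal.iSup_lt_of_lt_cof (by rwa [hμ.cof_ord]) fun s => ?_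
    exact (isSuccLimit_ord hμ.aleph0_le).succ_lt (hh ▸ hT.level_lt_height s.1)
  obtain ⟨t, htb, ht⟩ := hb.2.2 _ (hh.symm ▸ hlt)
  refine ⟨t, fun s hs => ⟨fun hsb => ?_, fun hst => hb.2.1 hst htb⟩⟩
  rcases hb.1.total hsb htb with h | h
  · exact h
  -- `t ≤ s` is impossible, since `t` was chosen on a level above that of `s`.
  · have h1 := hT.level_mono h
    have h2 : Order.succ (hT.level s) ≤ _ :=
      Ordinal.le_iSup (fun s : z => Order.succ (hT.level s.1)) ⟨s, hs⟩
    rw [← ht] at h2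
    exact absurd (h2.trans h1) (Order.lt_succ _).not_ge

/-- Coded branches form `B`, and coded cones `Set.Iic t` form `P`; there are at most `μ` cones
because there are `μ` nodes. -/
theorem IsWeakKurepaTree.exists_isWeakKurepaFamily {μ : Cardinal.{u}} (hμ : μ.IsRegular)
    {T : Type u} [PartialOrder T] (h : IsWeakKurepaTree μ T) :
    ∃ B P : ZFSet.{u}, IsWeakKurepaFamily μ μ.ord.toZFSet B P := by
  obtain ⟨hT, hh, hcard, hbr⟩ := h
  have hΩ : #T = #(Shrink.{u} μ.ord.toZFSet) := by
    rw [hcard, ← ZFSet.card, Ordinal.card_toZFSet, card_ord]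
  obtain ⟨g⟩ := Cardinal.eq.1 hΩ
  let f : T → ZFSet.{u} := fun t => ((equivShrink _).symm (g t)).1
  have hf : Function.Injective f := fun s t h =>
    g.injective ((equivShrink _).symm.injective (Subtype.ext h))
  have hfΩ : ∀ t, f t ∈ μ.ord.toZFSet := fun t => ((equivShrink _).symm (g t)).2
  let c : Set T → ZFSet.{u} := fun s => ZFSet.range fun t : s => f t
  have hc : ∀ s t, f t ∈ c s ↔ t ∈ s := by
    intro s t
    simp only [c, ZFSet.mem_range]
    exact ⟨fun ⟨a, ha⟩ => hf ha ▸ a.2, fun ha => ⟨⟨t, ha⟩, rfl⟩⟩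
  have hcΩ : ∀ s, c s ⊆ μ.ord.toZFSet := by
    intro s x hx
    obtain ⟨a, rfl⟩ := ZFSet.mem_range.1 hx
    exact hfΩ _
  have hcinj : Function.Injective c := fun s t h => by
    ext a
    rw [← hc, h, hc]
  refine ⟨ZFSet.range fun b : {b : Set T // hT.IsCofinalBranch b} => c b,
    ZFSet.range fun t : T => c (Set.Iic t), ?_, ?_, ?_, ?_, ?_⟩
  · intro b hb
    obtain ⟨a, rfl⟩ := ZFSet.mem_range.1 hb
    exact hcΩ _
  · intro b hb
    obtain ⟨a, rfl⟩ := ZFSet.mem_range.1 hb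
    exact hcΩ _
  · exact (card_range_le _).trans hcard.le
  · refine ((Order.lt_succ μ).trans_le hbr).trans_le (card_le_of_injective (fun b => c b.1)
      (hcinj.comp Subtype.val_injective) fun b => ZFSet.mem_range.2 ⟨b, rfl⟩)
  · intro b hb z hz
    obtain ⟨⟨b, hbr⟩, rfl⟩ := ZFSet.mem_range.1 hb
    have hz' : #{t | f t ∈ z} < μ :=
      (card_le_of_injective (fun t : {t | f t ∈ z} => f t.1)
        (hf.comp Subtype.val_injective) fun t => t.2).trans_lt hz
    obtain ⟨t, ht⟩ := hbr.exists_inter_eq hμ hh hz'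
    refine ⟨_, ZFSet.mem_range.2 ⟨t, rfl⟩, ?_⟩
    have key : ∀ s s' : Set T, (∀ a, f a ∈ z → a ∈ s → a ∈ s') → c s ∩ z ⊆ c s' ∩ z := by
      intro s s' hss x hx
      obtain ⟨hxs, hxz⟩ := ZFSet.mem_inter.1 hx
      obtain ⟨a, rfl⟩ := ZFSet.mem_range.1 hxs
      exact ZFSet.mem_inter.2 ⟨(hc _ _).2 (hss _ hxz a.2), hxz⟩
    exact subset_antisymm (key _ _ fun a ha hab => (ht a ha).1 hab)
      (key _ _ fun a ha hab => (ht a ha).2 hab)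

/-! ### Closure properties of `H θ` and `Pk κ X` -/

theorem ord_toZFSet_mem_H {μ θ : Cardinal.{u}} (h : μ < θ) : μ.ord.toZFSet ∈ H θ :=
  mem_H.2 ⟨_, (ZFSet.isOrdinal_toZFSet _).isTransitive, subset_rfl, by simpa using h⟩

theorem mem_H_of_subset {θ : Cardinal.{u}} {x y : ZFSet.{u}} (hy : y ∈ H θ) (h : x ⊆ y) :
    x ∈ H θ := by
  obtain ⟨t, ht, hyt, hcard⟩ := mem_H.1 hy
  exact mem_H.2 ⟨t, ht, h.trans hyt, hcard⟩

theorem ord_toZFSet_subset_H {μ θ : Cardinal.{u}} (h : μ ≤ θ) : μ.ord.toZFSet ⊆ H θ := by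
  intro x hx
  obtain ⟨a, ha, rfl⟩ := Ordinal.mem_toZFSet_iff.1 hx
  refine mem_H.2 ⟨_, (ZFSet.isOrdinal_toZFSet a).isTransitive, subset_rfl, ?_⟩
  rw [Ordinal.card_toZFSet]
  exact (lt_ord.1 ha).trans_le h

theorem card_sUnion_lt {κ : Cardinal.{u}} (hκ : κ.IsRegular) {D : ZFSet.{u}} (hD : D.card < κ)
    (h : ∀ y ∈ D, y.card < κ) : D.sUnion.card < κ := by
  have hU : D.sUnion = ZFSet.iUnion fun i : Shrink.{u} D => ((equivShrink D).symm i).1 := by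
    ext a
    rw [ZFSet.mem_sUnion, ZFSet.mem_iUnion]
    exact ⟨fun ⟨y, hy, ha⟩ => ⟨equivShrink D ⟨y, hy⟩, by simpa using ha⟩,
      fun ⟨i, ha⟩ => ⟨_, ((equivShrink D).symm i).2, ha⟩⟩
  rw [hU]
  refine lt_of_le_of_lt ?_ (sum_lt_of_isRegular hκ hD
    (f := fun i : Shrink.{u} D => ((equivShrink D).symm i).1.card)
    fun i => h _ ((equivShrink D).symm i).2)
  simpa using ZFSet.lift_card_iUnion_le_sum_card
    (f := fun i : Shrink.{u} D => ((equivShrink D).symm i).1)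

theorem sUnion_mem_Pk {κ : Cardinal.{u}} (hκ : κ.IsRegular) {X D : ZFSet.{u}} (hD : D.card < κ)
    (h : ∀ y ∈ D, y ∈ Pk κ X) : D.sUnion ∈ Pk κ X := by
  refine ⟨fun a ha => ?_, card_sUnion_lt hκ hD fun y hy => (h y hy).2⟩
  obtain ⟨y, hy, hay⟩ := ZFSet.mem_sUnion.1 ha
  exact (h y hy).1 hay

theorem union_mem_Pk {κ : Cardinal.{u}} (hκ : ℵ₀ ≤ κ) {X x y : ZFSet.{u}} (hx : x ∈ Pk κ X)
    (hy : y ∈ Pk κ X) : x ∪ y ∈ Pk κ X :=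
  ⟨fun _ ha => (ZFSet.mem_union.1 ha).elim (fun h => hx.1 h) fun h => hy.1 h,
    ZFSet.card_union_le.trans_lt (add_lt_of_lt hκ hx.2 hy.2)⟩

theorem singleton_mem_Pk {κ : Cardinal.{u}} (hκ : ℵ₀ ≤ κ) {X a : ZFSet.{u}} (ha : a ∈ X) :
    {a} ∈ Pk κ X :=
  ⟨fun b hb => ZFSet.mem_singleton.1 hb ▸ ha, by
    rw [ZFSet.card_singleton]
    exact one_lt_aleph0.trans_le hκ⟩

/-- The members of `𝒫_κ X` that include a given one form a strong club. -/
theorem isStrongClubIn_superset {κ : Cardinal.{u}} (hκ : κ.IsRegular)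
    {X A : ZFSet.{u}} (hA : A ∈ Pk κ X) : IsStrongClubIn κ X {M | M ∈ Pk κ X ∧ A ⊆ M} := by
  refine ⟨⟨fun M hM => hM.1, fun x hx => ⟨x ∪ A, ⟨union_mem_Pk hκ.aleph0_le hx hA,
    fun a ha => ZFSet.mem_union.2 (.inr ha)⟩, fun a ha => ZFSet.mem_union.2 (.inl ha)⟩⟩, ?_⟩
  rintro D ⟨M, hM⟩ hD hcard
  exact ⟨sUnion_mem_Pk hκ hcard fun y hy => (hD y hy).1,
    fun a ha => ZFSet.mem_sUnion.2 ⟨M, hM, (hD M hM).2 ha⟩⟩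

/-! ### Clubs of sets closed under intersections -/

/-- The closure of a set under binary intersections of its elements. -/
noncomputable def interClosure (x : ZFSet.{u}) : ZFSet.{u} :=
  ZFSet.range fun p : Shrink.{u} x × List (Shrink.{u} x) =>
    p.2.foldl (fun a i => a ∩ ((equivShrink x).symm i).1) ((equivShrink x).symm p.1).1

theorem card_interClosure_lt {κ : Cardinal.{u}} (hκ : ℵ₀ < κ) {x : ZFSet.{u}} (hx : x.card < κ) :
    (interClosure x).card < κ := by
  refine (card_range_le _).trans_lt ?_
  rw [mk_prod, Cardinal.lift_id, Cardinal.lift_id]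
  exact mul_lt_of_lt hκ.le hx ((mk_list_le_max _).trans_lt (max_lt hκ hx))

theorem subset_interClosure (x : ZFSet.{u}) : x ⊆ interClosure x := fun a ha =>
  ZFSet.mem_range.2 ⟨(equivShrink x ⟨a, ha⟩, []), by simp⟩

/-- An iterated intersection only shrinks its first term. As `H θ` is closed under subsets, the
closure therefore stays inside it. -/
theorem exists_subset_of_mem_interClosure {x a : ZFSet.{u}} (ha : a ∈ interClosure x) :
    ∃ b ∈ x, a ⊆ b := by
  obtain ⟨⟨i, l⟩, rfl⟩ := ZFSet.mem_range.1 ha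
  refine ⟨_, ((equivShrink x).symm i).2, ?_⟩
  induction l using List.reverseRecOn with
  | nil => exact subset_rfl
  | append_singleton l j ih =>
    intro c hc
    simp only [List.foldl_append, List.foldl_cons, List.foldl_nil, ZFSet.mem_inter] at hc
    exact ih (ZFSet.mem_range.2 ⟨(i, l), rfl⟩) hc.1

theorem inter_mem_interClosure {x a b : ZFSet.{u}} (ha : a ∈ interClosure x)
    (hb : b ∈ interClosure x) : a ∩ b ∈ interClosure x := by
  obtain ⟨⟨i, l⟩, rfl⟩ := ZFSet.mem_range.1 ha
  obtain ⟨⟨j, m⟩, rfl⟩ := ZFSet.mem_range.1 hb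
  refine ZFSet.mem_range.2 ⟨(i, l ++ j :: m), ?_⟩
  simp only [List.foldl_append, List.foldl_cons]
  generalize List.foldl _ _ l = c
  generalize ((equivShrink x).symm j).1 = d
  clear ha hb
  -- Concatenating the two words gives the intersection, by associativity.
  induction m using List.reverseRecOn with
  | nil => rfl
  | append_singleton m k ih =>
    simp only [List.foldl_append, List.foldl_cons, List.foldl_nil, ih]
    ext
    simp only [ZFSet.mem_inter, and_assoc]

/-- The members of `𝒫_κ H(θ)` that include a given one and are closed under binary intersections
form a club. -/
theorem isClubIn_inter_mem {κ θ : Cardinal.{u}} (hκ : κ.IsRegular) (hκ₀ : ℵ₀ < κ)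
    {A : ZFSet.{u}} (hA : A ∈ Pk κ (H θ)) :
    IsClubIn κ (H θ) {M | M ∈ Pk κ (H θ) ∧ A ⊆ M ∧ ∀ a ∈ M, ∀ b ∈ M, a ∩ b ∈ M} := by
  refine ⟨⟨fun M hM => hM.1, fun x hx => ?_⟩, ?_⟩
  · have hu := union_mem_Pk hκ₀.le hx hA
    refine ⟨interClosure (x ∪ A), ⟨⟨fun a ha => ?_, card_interClosure_lt hκ₀ hu.2⟩,
      fun a ha => subset_interClosure _ (ZFSet.mem_union.2 (.inr ha)),
      fun a ha b hb => inter_mem_interClosure ha hb⟩,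
      fun a ha => subset_interClosure _ (ZFSet.mem_union.2 (.inl ha))⟩
    obtain ⟨b, hb, hab⟩ := exists_subset_of_mem_interClosure ha
    exact mem_H_of_subset (hu.1 hb) hab
  · rintro D ⟨M, hM⟩ hD hcard hchain
    refine ⟨sUnion_mem_Pk hκ hcard fun y hy => (hD y hy).1,
      fun a ha => ZFSet.mem_sUnion.2 ⟨M, hM, (hD M hM).2.1 ha⟩, fun a ha b hb => ?_⟩
    obtain ⟨y, hy, hay⟩ := ZFSet.mem_sUnion.1 ha
    obtain ⟨z, hz, hbz⟩ := ZFSet.mem_sUnion.1 hb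
    -- Linearity of `D` puts both sets into one member; this is why the club need not be strong.
    rcases hchain y hy z hz with h | h
    · exact ZFSet.mem_sUnion.2 ⟨z, hz, (hD z hz).2.2 _ (h hay) _ hbz⟩
    · exact ZFSet.mem_sUnion.2 ⟨y, hy, (hD y hy).2.2 _ hay _ (h hbz)⟩

theorem IsWeakKurepaFamily.approx_mem_Pk {μ κ θ : Cardinal.{u}} {B P : ZFSet.{u}}
    (hF : IsWeakKurepaFamily μ μ.ord.toZFSet B P) (hκ : μ < κ) (hθ : μ < θ) :
    P ∈ Pk κ (H θ) :=
  ⟨fun _ he => mem_H_of_subset (ord_toZFSet_mem_H hθ) (hF.subset_of_mem_approx _ he),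
    hF.card_approx_le.trans_lt hκ⟩

/-! ### The guessing principle -/

theorem WAGP.not_isWeakKurepaFamily {μ : Cardinal.{u}} (hμ : ℵ₀ ≤ μ)
    (hW : WAGP μ (Order.succ μ) (Order.succ μ)) (B P : ZFSet.{u}) :
    ¬ IsWeakKurepaFamily μ μ.ord.toZFSet B P := by
  intro hF
  have hlt := Order.lt_succ μ
  have hreg := isRegular_succ hμ
  have hΩ := ord_toZFSet_mem_H hlt
  have hA : μ.ord.toZFSet ∈ Pk (Order.succ μ) (H (Order.succ μ)) :=
    ⟨ord_toZFSet_subset_H hlt.le, by simp⟩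
  obtain ⟨M, ⟨hMP, -, hM⟩, -, hPM⟩ := (hW _ (isStrongClubIn_superset hreg hA).1 _ hΩ).2 _
    (isStrongClubIn_superset hreg (hF.approx_mem_Pk hlt hlt))
  have hBM : ∀ b ∈ B, ∃ e ∈ M, e ∩ μ.ord.toZFSet = b := by
    intro b hb
    have hbΩ := hF.subset_of_mem b hb
    obtain ⟨N, ⟨-, hΩN⟩, -, hNM, e, heN, he⟩ := hM b hbΩ fun z _ hz =>
      let ⟨e, he, h⟩ := hF.exists_approx b hb z hz.2
      ⟨e, hPM he, h⟩
    refine ⟨e, hNM heN, ?_⟩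
    ext a
    have ha : a ∈ b ∩ N ↔ a ∈ e ∩ N := by rw [he]
    rw [ZFSet.mem_inter, ZFSet.mem_inter] at ha
    rw [ZFSet.mem_inter]
    exact ⟨fun h => (ha.2 ⟨h.1, hΩN h.2⟩).1,
      fun h => ⟨(ha.1 ⟨h, hΩN (hbΩ h)⟩).1, hbΩ h⟩⟩
  choose! g hgM hg using hBM
  have hle := card_le_of_injOn g (fun a ha b hb h => by rw [← hg a ha, ← hg b hb, h]) hgM
  exact (hF.lt_card.trans_le hle).not_ge (Order.lt_succ_iff.1 hMP.2)

/-! ### The slender tree property -/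

theorem card_powerset_ord_le_card_H (μ : Cardinal.{u}) :
    (ZFSet.powerset μ.ord.toZFSet).card ≤ (H (Order.succ μ)).card :=
  ZFSet.card_mono fun _ hb =>
    mem_H_of_subset (ord_toZFSet_mem_H (Order.lt_succ μ)) (ZFSet.mem_powerset.1 hb)

theorem SP.not_isWeakKurepaFamily {μ lam : Cardinal.{u}} (hμ : ℵ₀ ≤ μ)
    (hlam : (ZFSet.powerset μ.ord.toZFSet).card ≤ lam) (hS : SP μ (Order.succ μ) lam)
    (B P : ZFSet.{u}) : ¬ IsWeakKurepaFamily μ μ.ord.toZFSet B P := by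
  classical
  intro hF
  have hlt := Order.lt_succ μ
  have hreg := isRegular_succ hμ
  have hκ₀ := hμ.trans_lt hlt
  have hμlam : μ ≤ lam := by
    refine le_trans ?_ hlam
    rw [ZFSet.card_powerset, Ordinal.card_toZFSet, card_ord]
    exact (cantor μ).le
  have hΩX : μ.ord.toZFSet ⊆ lam.ord.toZFSet :=
    Ordinal.toZFSet_subset_toZFSet_iff.2 (ord_le_ord.2 hμlam)
  have hΩ : μ.ord.toZFSet ∈ Pk (Order.succ μ) lam.ord.toZFSet := ⟨hΩX, by simp⟩
  obtain ⟨p, hpX, hp⟩ := exists_injOn_of_card_le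
    (x := ZFSet.powerset μ.ord.toZFSet) (y := lam.ord.toZFSet)
    (by rwa [Ordinal.card_toZFSet, card_ord])
  have hex : ∀ z : ZFSet.{u}, z.card < Order.succ μ → ∃ b ∈ B, p b ∉ z := by
    intro z hz
    by_contra! h
    have hpow : ∀ b ∈ B, b ∈ ZFSet.powerset μ.ord.toZFSet := fun b hb =>
      ZFSet.mem_powerset.2 (hF.subset_of_mem b hb)
    have hle := card_le_of_injOn p (fun a ha b hb h => hp a (hpow a ha) b (hpow b hb) h) h
    exact (hF.lt_card.trans_le hle).not_ge (Order.lt_succ_iff.1 hz)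
  choose! β hβB hβ using hex
  -- The value `∅` keeps `d z ⊆ z` when `z` does not include `μ`.
  let d : ZFSet.{u} → ZFSet.{u} := fun z => if μ.ord.toZFSet ⊆ z then β z else ∅
  have hd : ∀ z, μ.ord.toZFSet ⊆ z → d z = β z := fun z hz => if_pos hz
  have hlist : IsPkList (Order.succ μ) lam.ord.toZFSet d := by
    intro x hx
    by_cases h : μ.ord.toZFSet ⊆ x
    · rw [hd x h]
      exact (hF.subset_of_mem _ (hβB x hx.2)).trans h
    · simp only [d, if_neg h]
      exact ZFSet.empty_subset x
  have hslender : IsSlender μ (Order.succ μ) lam.ord.toZFSet d := by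
    refine ⟨Order.succ μ, fun θ hθ => ?_⟩
    have hμθ := hlt.trans_le hθ
    have hΩH : μ.ord.toZFSet ∈ Pk (Order.succ μ) (H θ) :=
      ⟨ord_toZFSet_subset_H hμθ.le, hΩ.2⟩
    refine ⟨_, isClubIn_inter_mem hreg hκ₀
      (union_mem_Pk hκ₀.le hΩH (hF.approx_mem_Pk hlt hμθ)), ?_⟩
    rintro M ⟨hMP, hAM, hM⟩ y hyM hy
    have hΩM : μ.ord.toZFSet ⊆ M ∩ lam.ord.toZFSet := fun a ha =>
      ZFSet.mem_inter.2 ⟨hAM (ZFSet.mem_union.2 (.inl ha)), hΩX ha⟩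
    have hcard : (M ∩ lam.ord.toZFSet).card < Order.succ μ :=
      (ZFSet.card_mono fun a ha => (ZFSet.mem_inter.1 ha).1).trans_lt hMP.2
    rw [hd _ hΩM]
    obtain ⟨e, he, hey⟩ := hF.exists_approx _ (hβB _ hcard) y hy.2
    -- The piece is now `e ∩ y` with `e ∈ P ⊆ M` and `y ∈ M`.
    rw [hey]
    exact hM _ (hAM (ZFSet.mem_union.2 (.inr he))) _ hyM
  obtain ⟨b, -, hb⟩ := hS d hlist hslender
  have hbΩ : b ∩ μ.ord.toZFSet ∈ ZFSet.powerset μ.ord.toZFSet :=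
    ZFSet.mem_powerset.2 fun a ha => (ZFSet.mem_inter.1 ha).2
  -- Test the branch on `μ` together with the code of its own trace on `μ`.
  obtain ⟨z, hz, hNz, hbz⟩ := hb _
    (union_mem_Pk hκ₀.le hΩ (singleton_mem_Pk hκ₀.le (hpX _ hbΩ)))
  have hΩz : μ.ord.toZFSet ⊆ z := fun a ha => hNz (ZFSet.mem_union.2 (.inl ha))
  have hpz : p (b ∩ μ.ord.toZFSet) ∈ z :=
    hNz (ZFSet.mem_union.2 (.inr (ZFSet.mem_singleton.2 rfl)))
  refine hβ z hz.2 ?_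
  -- It remains to see that `β z` is that trace, which contradicts its code being outside `z`.
  convert hpz using 2
  rw [hd z hΩz] at hbz
  ext a
  have hsub := hF.subset_of_mem _ (hβB z hz.2)
  have ha := ZFSet.ext_iff.1 hbz a
  simp only [ZFSet.mem_inter, ZFSet.mem_union] at ha ⊢
  exact ⟨fun h => ⟨(ha.2 ⟨h, .inl (hsub h)⟩).1, hsub h⟩, fun h => (ha.1 ⟨h.1, .inl h.2⟩).1⟩

end TwoCardinal

theorem mainTheorem2 :
    (∀ μ : Cardinal.{u}, μ.IsRegular → ℵ₀ < μ →
      WAGP μ (Order.succ μ) (Order.succ μ) →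
        ∀ (T : Type u) [PartialOrder T], ¬ IsWeakKurepaTree μ T) ∧
    (SP (ℵ_ 1) (ℵ_ 2) (H (ℵ_ 2 : Cardinal.{u})).card →
      ∀ (T : Type u) [PartialOrder T], ¬ IsWeakKurepaTree (ℵ_ 1) T) := by
  refine ⟨fun μ hμ _ hW T _ hT => ?_, fun hS T _ hT => ?_⟩
  · obtain ⟨B, P, hF⟩ := hT.exists_isWeakKurepaFamily hμ
    exact hW.not_isWeakKurepaFamily hμ.aleph0_le B P hF
  · have h2 : (ℵ_ 2 : Cardinal.{u}) = Order.succ (ℵ_ 1) := by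
      rw [succ_aleph, one_add_one_eq_two]
    rw [h2] at hS
    obtain ⟨B, P, hF⟩ := hT.exists_isWeakKurepaFamily isRegular_aleph_one
    exact SP.not_isWeakKurepaFamily (aleph0_le_aleph 1) (card_powerset_ord_le_card_H _) hS B P hF
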